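/- Let $2\le n<\infty$ and let $\mathcal O_n$ be the Cuntz algebra with Cuntz generators $s_1,\dots,s_n$, that is, the universal unital C$^*$-algebra generated by $s_1,\dots,s_n$ subject to $s_i^*s_j=\delta_{ij}I$ and $\sum_{i=1}^n s_is_i^*=I$. For a state $\omega$ on $\mathcal O_n$ with GNS representation $(\mathcal H,\pi,\Omega)$ put $$\mathcal K(\omega):=\overline{\mathrm{span}}\{\pi(s_{j_1}\cdots s_{j_l})^*\Omega : l\ge 0,\ 1\le j_1,\dots,j_l\le n\}\subset\mathcal H,\qquad \mathrm{cdim}\,\omega:=\dim\mathcal K(\omega)\in\{1,2,\dots,\infty\},$$ where the empty product is $I$, and $$\kappa(\omega):=\min\{\mathrm{cdim}\,\omega' : \omega' \text{ a state on } \mathcal O_n \text{ whose GNS representation is unitarily equivalent to that of } \omega\}.$$ The state $\omega$ is called minimal if $\mathrm{cdim}\,\omega=\kappa(\omega)$. A state $\omega$ on $\mathcal O_n$ is called a geometric progression state if one of the following holds: (i) (order $k$) there are an integer $k\ge 2$ and, with $m:=(n-1)k+1$, a unit vector $z=(z_1,\dots,z_m)\in\mathbb C^m$ such that $\omega(s_n^rs_i)=\overline{z_{(n-1)r+i}}$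 for all $0\le r\le k-1$ and $1\le i\le n-1$, and $\omega(s_n^k)=\overline{z_m}$; (ii) ($\ell^2$ version) there is a unit vector $z=(z_1,z_2,\dots)\in\ell^2$ such that $\omega(s_n^rs_i)=\overline{z_{(n-1)r+i}}$ for all $r\ge 0$ and $1\le i\le n-1$. Then every geometric progression state on $\mathcal O_n$ is minimal. -/

import Mathlib

open scoped ComplexOrder ENNReal

/-! ### The Cuntz algebra -/

/-- A family of Cuntz generators `t₁, …, tₙ` in some nonzero unital C⋆-algebra:
`tᵢ* tⱼ = δᵢⱼ 1` and `∑ᵢ tᵢ tᵢ* = 1`. -/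
structure CuntzFamily (n : ℕ) where
  /-- the C⋆-algebra that contains the family -/
  carrier : Type
  [cstar : CStarAlgebra carrier]
  [nontriv : Nontrivial carrier]
  /-- the generators -/
  gen : Fin n → carrier
  star_gen_mul_gen : ∀ i j, star (gen i) * gen j = if i = j then 1 else 0
  sum_gen_mul_star_gen : ∑ i, gen i * star (gen i) = 1

attribute [instance] CuntzFamily.cstar CuntzFamily.nontriv

/-- The C⋆-product (bounded families, supremum norm) of the ambient algebras of all families of
Cuntz generators. -/
noncomputable abbrev CuntzProduct (n : ℕ) := lp (fun F : CuntzFamily n => F.carrier) ∞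

noncomputable instance CuntzProduct.cstarAlgebra (n : ℕ) : CStarAlgebra (CuntzProduct n) where

theorem CuntzFamily.norm_gen_le {n : ℕ} (F : CuntzFamily n) (i : Fin n) : ‖F.gen i‖ ≤ 1 := by
  have h : ‖F.gen i‖ * ‖F.gen i‖ = 1 := by
    rw [← CStarRing.norm_star_mul_self, F.star_gen_mul_gen, if_pos rfl, norm_one]
  nlinarith [norm_nonneg (F.gen i)]

/-- The tuple, over all families of Cuntz generators, of their `i`-th generators. -/
noncomputable def CuntzProduct.gen (n : ℕ) (i : Fin n) : CuntzProduct n :=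
  ⟨fun F => F.gen i, memℓp_infty ⟨1, by rintro _ ⟨F, rfl⟩; exact F.norm_gen_le i⟩⟩

/-- The C⋆-subalgebra of the product generated by the tuples of generators. -/
noncomputable def CuntzProduct.generated (n : ℕ) : StarSubalgebra ℂ (CuntzProduct n) :=
  (StarAlgebra.adjoin ℂ (Set.range (CuntzProduct.gen n))).topologicalClosure

/-- The Cuntz algebra `𝒪ₙ`: the C⋆-algebra universally generated by `s₁, …, sₙ` subject to
`sᵢ* sⱼ = δᵢⱼ 1` and `∑ᵢ sᵢ sᵢ* = 1`, i.e. the C⋆-algebra generated by the `sᵢ` in the norm that is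
the supremum over all families of Cuntz generators. (Letting the families range over algebras in
`Type` loses nothing: a C⋆-algebra generated by finitely many elements has at most the cardinality
of the continuum.) See `CuntzAlgebra.star_gen_mul_gen`, `CuntzAlgebra.sum_gen_mul_star_gen`,
`CuntzAlgebra.dense_adjoin_gen`, `CuntzAlgebra.exists_starAlgHom` for the defining properties. -/
noncomputable def CuntzAlgebra (n : ℕ) : Type 1 := CuntzProduct.generated n

namespace CuntzAlgebra

noncomputable instance (n : ℕ) : CStarAlgebra (CuntzAlgebra n) :=
  StarSubalgebra.cstarAlgebra (CuntzProduct.generated n)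
    (h_closed := StarSubalgebra.isClosed_topologicalClosure _)

/-- The usual order of a C⋆-algebra: `a ≤ b` iff `b - a` is of the form `c* c`. -/
noncomputable instance (n : ℕ) : PartialOrder (CuntzAlgebra n) :=
  CStarAlgebra.spectralOrder (CuntzAlgebra n)

instance (n : ℕ) : StarOrderedRing (CuntzAlgebra n) :=
  CStarAlgebra.spectralOrderedRing (CuntzAlgebra n)

/-- The canonical Cuntz generators `s₁, …, sₙ` of `𝒪ₙ` (indexed from `0`). -/
noncomputable def gen {n : ℕ} (i : Fin n) : CuntzAlgebra n :=
  ⟨CuntzProduct.gen n i, StarSubalgebra.le_topologicalClosure _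
    (StarAlgebra.subset_adjoin ℂ _ ⟨i, rfl⟩)⟩

/-- The inclusion of `𝒪ₙ` in the product. -/
noncomputable def incl (n : ℕ) : CuntzAlgebra n →⋆ₐ[ℂ] CuntzProduct n :=
  (CuntzProduct.generated n).subtype

theorem incl_injective (n : ℕ) : Function.Injective (incl n) := Subtype.val_injective

/-- The component of `𝒪ₙ` at a family of Cuntz generators. -/
noncomputable def eval {n : ℕ} (F : CuntzFamily n) : CuntzAlgebra n →⋆ₐ[ℂ] F.carrier where
  toFun a := (incl n a : ∀ F : CuntzFamily n, F.carrier) F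
  map_one' := by rw [map_one, lp.infty_coeFn_one]; rfl
  map_mul' a b := by rw [map_mul, lp.infty_coeFn_mul]; rfl
  map_zero' := by rw [map_zero, lp.coeFn_zero]; rfl
  map_add' a b := by rw [map_add, lp.coeFn_add]; rfl
  commutes' c := by
    rw [Algebra.algebraMap_eq_smul_one, map_smul, map_one, lp.coeFn_smul, lp.infty_coeFn_one,
      Algebra.algebraMap_eq_smul_one]
    rfl
  map_star' a := by rw [map_star, lp.coeFn_star]; rfl

theorem eval_gen {n : ℕ} (F : CuntzFamily n) (i : Fin n) : eval F (gen i) = F.gen i := rfl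

theorem ext_eval {n : ℕ} {a b : CuntzAlgebra n} (h : ∀ F, eval F a = eval F b) : a = b :=
  incl_injective n (lp.ext (funext h))

theorem star_gen_mul_gen {n : ℕ} (i j : Fin n) :
    star (gen i) * gen j = if i = j then 1 else 0 := by
  refine ext_eval fun F => ?_
  rw [map_mul, map_star, eval_gen, eval_gen, F.star_gen_mul_gen]
  split_ifs <;> simp

theorem sum_gen_mul_star_gen (n : ℕ) : ∑ i : Fin n, gen i * star (gen i) = 1 := by
  refine ext_eval fun F => ?_
  simp only [map_sum, map_mul, map_star, eval_gen, map_one, F.sum_gen_mul_star_gen]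

/-- `𝒪ₙ` is generated by `s₁, …, sₙ` as a C⋆-algebra. -/
theorem dense_adjoin_gen (n : ℕ) :
    Dense (StarAlgebra.adjoin ℂ (Set.range (gen : Fin n → CuntzAlgebra n)) :
      Set (CuntzAlgebra n)) := by
  intro a
  have hmap : StarAlgebra.adjoin ℂ (Set.range (CuntzProduct.gen n)) =
      (StarAlgebra.adjoin ℂ (Set.range (gen : Fin n → CuntzAlgebra n))).map (incl n) := by
    rw [StarAlgHom.map_adjoin, ← Set.range_comp]
    rfl
  have hind : Topology.IsInducing (incl n) := ⟨rfl⟩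
  rw [hind.closure_eq_preimage_closure_image, Set.mem_preimage, ← StarSubalgebra.coe_map, ← hmap,
    ← StarSubalgebra.topologicalClosure_coe]
  exact a.2

/-- Universality: any family of Cuntz generators is the image of `s₁, …, sₙ` under a unital
⋆-homomorphism defined on `𝒪ₙ`. -/
theorem exists_starAlgHom {n : ℕ} (F : CuntzFamily n) :
    ∃ φ : CuntzAlgebra n →⋆ₐ[ℂ] F.carrier, ∀ i, φ (gen i) = F.gen i :=
  ⟨eval F, eval_gen F⟩

attribute [irreducible] CuntzAlgebra.instCStarAlgebra

end CuntzAlgebra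

/-! ### States on C⋆-algebras and their GNS representations -/

section States

variable (A : Type*) [CStarAlgebra A] [PartialOrder A] [StarOrderedRing A]

/-- The states on a unital C⋆-algebra: the positive linear functionals `ω` with `ω(1) = 1`. -/
noncomputable def CStarState := {ω : A →ₚ[ℂ] ℂ // ω 1 = 1}

end States

namespace CStarState

section GNS

variable {A : Type*} [CStarAlgebra A] [PartialOrder A] [StarOrderedRing A]

noncomputable instance : CoeFun (CStarState A) (fun _ => A → ℂ) := ⟨fun ω a => ω.1 a⟩

/-- The cyclic vector `Ω` of the GNS representation of `ω`: the class of the unit of `A`. The GNS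
representation itself is `ω.1.gnsStarAlgHom`, on the Hilbert space `ω.1.GNS`. -/
noncomputable def cyclicVector (ω : CStarState A) : ω.1.GNS :=
  ((ω.1.toPreGNS 1 : ω.1.PreGNS) : UniformSpace.Completion ω.1.PreGNS)

/-- `ω ∼ ω'`: the GNS representations of `ω` and `ω'` are unitarily equivalent. -/
def Equivalent (ω ω' : CStarState A) : Prop :=
  ∃ U : ω.1.GNS ≃ₗᵢ[ℂ] ω'.1.GNS,
    ∀ (a : A) (x : ω.1.GNS), U (ω.1.gnsStarAlgHom a x) = ω'.1.gnsStarAlgHom a (U x)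

end GNS

variable {n : ℕ}

/-- The word `s_J = s_{j₁} ⋯ s_{jₗ}` in the Cuntz generators; `s_∅ = 1`. -/
noncomputable def word (J : List (Fin n)) : CuntzAlgebra n := (J.map CuntzAlgebra.gen).prod

/-- `𝒦(ω)`: the closed linear span of the vectors `π(s_J)* Ω` in the GNS space of `ω`. -/
noncomputable def corrSpace (ω : CStarState (CuntzAlgebra n)) : Submodule ℂ ω.1.GNS :=
  (Submodule.span ℂ (Set.range fun J : List (Fin n) =>
    ContinuousLinearMap.adjoint (ω.1.gnsStarAlgHom (word J)) ω.cyclicVector)).topologicalClosure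

/-- `cdim ω = dim 𝒦(ω) ∈ {1, 2, …, ∞}`. (For a Hilbert space, the orthonormal and the algebraic
dimension agree when one of them is finite, and all infinite dimensions are sent to `∞`.) -/
noncomputable def cdim (ω : CStarState (CuntzAlgebra n)) : ℕ∞ :=
  Cardinal.toENat (Module.rank ℂ ω.corrSpace)

/-- `κ(ω)`: the least `cdim ω'` over the states `ω'` that are equivalent to `ω`. -/
noncomputable def kappa (ω : CStarState (CuntzAlgebra n)) : ℕ∞ :=
  sInf {d | ∃ ω' : CStarState (CuntzAlgebra n), ω'.Equivalent ω ∧ ω'.cdim = d}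

/-- A state is minimal if `cdim ω = κ(ω)`. -/
def IsMinimal (ω : CStarState (CuntzAlgebra n)) : Prop := ω.cdim = ω.kappa

/-! ### Geometric progression states -/

/-- The last generator `sₙ` of `𝒪ₙ`. -/
noncomputable def lastGen (hn : 2 ≤ n) : CuntzAlgebra n :=
  CuntzAlgebra.gen ⟨n - 1, by omega⟩

/-- The generator `s_{i+1}`, for `i = 0, …, n - 2`: the generators other than the last. -/
noncomputable def initGen (i : Fin (n - 1)) : CuntzAlgebra n :=
  CuntzAlgebra.gen ⟨i, by omega⟩

theorem index_lt {k : ℕ} (r : Fin k) (i : Fin (n - 1)) :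
    (n - 1) * (r : ℕ) + (i : ℕ) < (n - 1) * k + 1 := by
  have h : (n - 1) * ((r : ℕ) + 1) ≤ (n - 1) * k := Nat.mul_le_mul_left _ r.2
  have := i.2
  rw [Nat.mul_add] at h
  omega

/-- `ω` is a geometric progression state of order `k` by the vector `z ∈ ℂᵐ`, `m = (n-1)k + 1`:
`ω(sₙʳ sᵢ)` is the conjugate of `z_{(n-1)r+i}` for `0 ≤ r < k`, `1 ≤ i ≤ n - 1`, and `ω(sₙᵏ)` is the
conjugate of `zₘ`. In the code `i` and the coordinates of `z` are indexed from `0`. -/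
def IsGeometricOfOrder (hn : 2 ≤ n) (k : ℕ) (z : EuclideanSpace ℂ (Fin ((n - 1) * k + 1)))
    (ω : CStarState (CuntzAlgebra n)) : Prop :=
  (∀ (r : Fin k) (i : Fin (n - 1)),
    ω (lastGen hn ^ (r : ℕ) * initGen i) = star (z ⟨(n - 1) * (r : ℕ) + (i : ℕ), index_lt r i⟩)) ∧
  ω (lastGen hn ^ k) = star (z (Fin.last _))

/-- `ω` is a geometric progression state by the sequence `z ∈ ℓ²`: `ω(sₙʳ sᵢ)` is the conjugate of
`z_{(n-1)r+i}` for all `r ≥ 0`, `1 ≤ i ≤ n - 1` (with the same shift of indices). -/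
def IsGeometricL2 (hn : 2 ≤ n) (z : lp (fun _ : ℕ => ℂ) 2)
    (ω : CStarState (CuntzAlgebra n)) : Prop :=
  ∀ (r : ℕ) (i : Fin (n - 1)),
    ω (lastGen hn ^ r * initGen i) = star (z ((n - 1) * r + (i : ℕ)))

/-- A geometric progression state: of some finite order `k ≥ 2` by a unit vector of `ℂᵐ`, or by a
unit vector of `ℓ²`. -/
def IsGeometricProgressionState (hn : 2 ≤ n) (ω : CStarState (CuntzAlgebra n)) : Prop :=
  (∃ k : ℕ, 2 ≤ k ∧ ∃ z : EuclideanSpace ℂ (Fin ((n - 1) * k + 1)),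
    ‖z‖ = 1 ∧ ω.IsGeometricOfOrder hn k z) ∨
  (∃ z : lp (fun _ : ℕ => ℂ) 2, ‖z‖ = 1 ∧ ω.IsGeometricL2 hn z)

end CStarState

/-! The words `t_j` (all `sₙʳ sᵢ`, or those with `r < k` together with `sₙᵏ`) are isometries with
orthogonal ranges. Since `⟨Ω, t_j Ω⟩ = conj z_j` and `z` is a unit vector, the equality case of
Cauchy-Schwarz gives `Ω = ∑ z_j t_j Ω` (`hasSum_smul_of_hasSum_inner`).

For an equivalent state `ω'`, view `Ω` in the GNS space of `ω'` and let `M = 𝒦(ω')`, which is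
invariant under all `sᵢ*` and contains the cyclic vector `Ω'`. The projection `v` of `Ω` to `M`
satisfies the same fixed-point equation, hence so does `u = Ω - v ∈ Mᗮ`. Because the `t_j` are
nonempty words, that equation makes the closed span of the `s_J u` a subrepresentation
(`map_mem_wordSpan`). It lies in `Mᗮ`, so it is orthogonal to `Ω'`, and cyclicity forces `u = 0`
(`mem_of_cyclic`). Thus `Ω ∈ 𝒦(ω')`, so `𝒦(ω)` embeds in `𝒦(ω')` and `cdim ω ≤ cdim ω'`. -/

open scoped InnerProductSpace
open Filter Topology

/-! ### Equality in Cauchy-Schwarz for orthogonal isometries -/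

/-- If `V j` are isometries with pairwise orthogonal ranges and `∑ |z j|² = 1`, then a vector `x`
whose inner product with `∑ z j V j x` is `‖x‖²` is fixed by `∑ z j V j`. -/
theorem hasSum_smul_of_hasSum_inner {H ι : Type*} [NormedAddCommGroup H] [InnerProductSpace ℂ H]
    [DecidableEq ι] {V : ι → H →L[ℂ] H}
    (hV : ∀ i j x y, ⟪V i x, V j y⟫_ℂ = if i = j then ⟪x, y⟫_ℂ else 0)
    {z : ι → ℂ} (hz : HasSum (fun j => ‖z j‖ ^ 2) 1) {x : H}
    (hx : HasSum (fun j => z j * ⟪x, V j x⟫_ℂ) ((‖x‖ : ℂ) ^ 2)) :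
    HasSum (fun j => z j • V j x) x := by
  have key : ∀ s : Finset ι, ‖∑ j ∈ s, z j • V j x - x‖ ^ 2 =
      (∑ j ∈ s, ‖z j‖ ^ 2) * ‖x‖ ^ 2 - 2 * (∑ j ∈ s, z j * ⟪x, V j x⟫_ℂ).re + ‖x‖ ^ 2 := by
    intro s
    have h1 : ‖∑ j ∈ s, z j • V j x‖ ^ 2 = (∑ j ∈ s, ‖z j‖ ^ 2) * ‖x‖ ^ 2 := by
      apply Complex.ofReal_injective
      have := inner_self_eq_norm_sq_to_K (𝕜 := ℂ) (∑ j ∈ s, z j • V j x)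
      push_cast
      refine this.symm.trans ?_
      rw [sum_inner, Finset.sum_mul]
      refine Finset.sum_congr rfl fun i hi => ?_
      rw [inner_sum, Finset.sum_eq_single i]
      · rw [inner_smul_left, inner_smul_right, hV, if_pos rfl, ← mul_assoc,
          ← Complex.conj_mul', inner_self_eq_norm_sq_to_K]
        rfl
      · intro j _ hj
        rw [inner_smul_left, inner_smul_right, hV, if_neg hj.symm, mul_zero, mul_zero]
      · exact fun h => absurd hi h
    rw [norm_sub_sq (𝕜 := ℂ), h1, ← inner_conj_symm, inner_sum]
    simp only [inner_smul_right, RCLike.conj_re]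
    rfl
  have hre : HasSum (fun j => (z j * ⟪x, V j x⟫_ℂ).re) (‖x‖ ^ 2) := by
    simpa [← Complex.ofReal_pow] using Complex.hasSum_re hx
  -- The squared distance tends to `1 * ‖x‖² - 2 * ‖x‖² + ‖x‖² = 0`.
  have hlim : Tendsto (fun s : Finset ι => ‖∑ j ∈ s, z j • V j x - x‖ ^ 2) atTop (𝓝 0) := by
    have h2 : Tendsto (fun s : Finset ι => (∑ j ∈ s, ‖z j‖ ^ 2) * ‖x‖ ^ 2 -
        2 * (∑ j ∈ s, (z j * ⟪x, V j x⟫_ℂ).re) + ‖x‖ ^ 2) atTop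
        (𝓝 (1 * ‖x‖ ^ 2 - 2 * ‖x‖ ^ 2 + ‖x‖ ^ 2)) :=
      ((Tendsto.mul_const _ hz).sub (Tendsto.const_mul _ hre)).add_const _
    refine (h2.congr fun s => ?_).trans (by ring_nf; rfl)
    rw [key, Complex.re_sum]
  have h3 := hlim.sqrt
  simp only [Real.sqrt_zero, Real.sqrt_sq (norm_nonneg _)] at h3
  exact tendsto_iff_norm_sub_tendsto_zero.2 h3

namespace CuntzAlgebra

/-- A closed subspace that is invariant under the generators and their adjoints is invariant under
the Cuntz algebra. -/
theorem apply_mem_of_generators {n : ℕ} {H : Type*} [NormedAddCommGroup H] [InnerProductSpace ℂ H]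
    [CompleteSpace H] (π : CuntzAlgebra n →⋆ₐ[ℂ] (H →L[ℂ] H)) {R : Submodule ℂ H}
    (hR : IsClosed (R : Set H)) (hgen : ∀ i, ∀ x ∈ R, π (gen i) x ∈ R)
    (hstar : ∀ i, ∀ x ∈ R, π (star (gen i)) x ∈ R) (a : CuntzAlgebra n) {x : H} (hx : x ∈ R) :
    π a x ∈ R := by
  have hcont : Continuous fun a => π a x :=
    (ContinuousLinearMap.apply ℂ H x).continuous.comp (map_continuous π)
  refine isClosed_property (dense_adjoin_gen n).denseRange_val (hR.preimage hcont) ?_ a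
  rintro ⟨b, hb⟩
  change π b x ∈ R
  -- The star-adjoin becomes the plain adjoin of the generators and their adjoints, so the induction
  -- has no case for `star`.
  rw [SetLike.mem_coe, ← StarSubalgebra.mem_toSubalgebra, StarAlgebra.adjoin_toSubalgebra] at hb
  clear hcont
  induction hb using Algebra.adjoin_induction generalizing x with
  | mem b hb =>
    rcases hb with ⟨i, rfl⟩ | ⟨i, hi⟩
    · exact hgen i x hx
    · rw [← star_star b, ← hi]
      exact hstar i x hx
  | algebraMap c =>
    rw [AlgHomClass.commutes, Algebra.algebraMap_eq_smul_one]
    exact R.smul_mem c hx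
  | add a b _ _ ha hb =>
    rw [map_add]
    exact R.add_mem (ha hx) (hb hx)
  | mul a b _ _ ha hb =>
    rw [map_mul]
    exact ha (hb hx)

end CuntzAlgebra

namespace CStarState

variable {n : ℕ}

theorem word_cons (i : Fin n) (J : List (Fin n)) :
    word (i :: J) = CuntzAlgebra.gen i * word J := by
  simp [word]

theorem word_append (J L : List (Fin n)) : word (J ++ L) = word J * word L := by
  simp [word]

/-! ### Invariant subspaces of a representation -/

section Representation

variable {H : Type*} [NormedAddCommGroup H] [InnerProductSpace ℂ H] [CompleteSpace H]
  (π : CuntzAlgebra n →⋆ₐ[ℂ] (H →L[ℂ] H))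


theorem inner_map_left (a : CuntzAlgebra n) (x y : H) : ⟪π a x, y⟫_ℂ = ⟪x, π (star a) y⟫_ℂ := by
  rw [map_star, ContinuousLinearMap.star_eq_adjoint, ContinuousLinearMap.adjoint_inner_right]

theorem inner_map_right (a : CuntzAlgebra n) (x y : H) : ⟪x, π a y⟫_ℂ = ⟪π (star a) x, y⟫_ℂ := by
  rw [inner_map_left, star_star]

theorem word_apply_mem {N : Submodule ℂ H} (hN : ∀ i, ∀ x ∈ N, π (CuntzAlgebra.gen i) x ∈ N)
    (J : List (Fin n)) {x : H} (hx : x ∈ N) : π (word J) x ∈ N := by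
  induction J with
  | nil => simpa [word] using hx
  | cons i J ih =>
    rw [word_cons, map_mul]
    exact hN i _ ih

theorem star_word_apply_mem {M : Submodule ℂ H}
    (hM : ∀ i, ∀ x ∈ M, π (star (CuntzAlgebra.gen i)) x ∈ M)
    (J : List (Fin n)) {x : H} (hx : x ∈ M) : π (star (word J)) x ∈ M := by
  induction J generalizing x with
  | nil => simpa [word] using hx
  | cons i J ih =>
    rw [word_cons, star_mul, map_mul]
    exact ih (hM i _ hx)

/-- The closed linear span of the vectors `π(s_J) u`. -/
noncomputable def wordSpan (u : H) : Submodule ℂ H :=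
  (Submodule.span ℂ (Set.range fun J : List (Fin n) => π (word J) u)).topologicalClosure

theorem word_apply_mem_wordSpan (u : H) (J : List (Fin n)) : π (word J) u ∈ wordSpan π u :=
  Submodule.le_topologicalClosure _ (Submodule.subset_span ⟨J, rfl⟩)

theorem isClosed_wordSpan (u : H) : IsClosed (wordSpan π u : Set H) :=
  Submodule.isClosed_topologicalClosure _

theorem wordSpan_le {u : H} {N : Submodule ℂ H} (hN : IsClosed (N : Set H))
    (h : ∀ J : List (Fin n), π (word J) u ∈ N) : wordSpan π u ≤ N :=
  Submodule.topologicalClosure_minimal _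
    (Submodule.span_le.2 (Set.range_subset_iff.2 h)) hN

theorem apply_mem_of_mem_wordSpan {u x : H} (hx : x ∈ wordSpan π u) (A : H →L[ℂ] H)
    (hA : ∀ J : List (Fin n), A (π (word J) u) ∈ wordSpan π u) : A x ∈ wordSpan π u :=
  wordSpan_le π (N := (wordSpan π u).comap (A : H →ₗ[ℂ] H))
    ((isClosed_wordSpan π u).preimage A.continuous) hA hx

/-- If `u` is a sum of multiples of vectors `π(s_J) u` with nonempty `J`, then the closed linear
span of the `π(s_J) u` is invariant under the Cuntz algebra. -/
theorem map_mem_wordSpan {ι : Type*} {J : ι → List (Fin n)} (hJ : ∀ j, J j ≠ []) {z : ι → ℂ}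
    {u : H} (hu : HasSum (fun j => z j • π (word (J j)) u) u) (a : CuntzAlgebra n) {x : H}
    (hx : x ∈ wordSpan π u) : π a x ∈ wordSpan π u := by
  -- An adjoint generator removes the first letter of a nonempty word or kills the vector.
  have hcons : ∀ i j (L : List (Fin n)),
      π (star (CuntzAlgebra.gen i)) (π (word (j :: L)) u) ∈ wordSpan π u := by
    intro i j L
    rw [← mul_apply_eq_comp, ← map_mul, word_cons, ← mul_assoc,
      CuntzAlgebra.star_gen_mul_gen]
    split_ifs
    · rw [one_mul]
      exact word_apply_mem_wordSpan π u L
    · simp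
  refine CuntzAlgebra.apply_mem_of_generators π (isClosed_wordSpan π u) (fun i x hx => ?_)
    (fun i x hx => ?_) a hx
  · refine apply_mem_of_mem_wordSpan π hx _ fun L => ?_
    rw [← mul_apply_eq_comp, ← map_mul, ← word_cons]
    exact word_apply_mem_wordSpan π u _
  · refine apply_mem_of_mem_wordSpan π hx _ fun L => ?_
    cases L with
    | cons j L => exact hcons i j L
    | nil =>
      -- Only the empty word needs the fixed-point equation: it rewrites `u` through nonempty words,
      -- to which `hcons` applies.
      have h := hu.mapL (π (star (CuntzAlgebra.gen i)))
      simp only [word, List.map_nil, List.prod_nil, map_one, one_apply_eq_self]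
      refine (isClosed_wordSpan π u).mem_of_tendsto h (Eventually.of_forall fun s => ?_)
      refine Submodule.sum_mem _ fun j _ => ?_
      rw [map_smul]
      refine Submodule.smul_mem _ _ ?_
      obtain ⟨j', L, h'⟩ := List.exists_cons_of_ne_nil (hJ j)
      rw [h']
      exact hcons i j' L

/-- Let `t_j` be nonempty words with pairwise orthogonal ranges, `z` a unit vector, and `Ω` a unit
vector with `⟨Ω, t_j Ω⟩ = conj z_j`. Then `Ω` lies in each closed subspace that is invariant under
the adjoints of the generators and contains a cyclic vector. -/
theorem mem_of_cyclic {ι : Type*} [DecidableEq ι] {J : ι → List (Fin n)} (hJ : ∀ j, J j ≠ [])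
    (horth : ∀ i j, star (word (J i)) * word (J j) = if i = j then 1 else 0)
    {z : ι → ℂ} (hz : HasSum (fun j => ‖z j‖ ^ 2) 1) {Ω : H} (hΩ : ‖Ω‖ = 1)
    (hΩz : ∀ j, ⟪Ω, π (word (J j)) Ω⟫_ℂ = star (z j))
    {M : Submodule ℂ H} (hM : IsClosed (M : Set H))
    (hinv : ∀ i, ∀ x ∈ M, π (star (CuntzAlgebra.gen i)) x ∈ M)
    {ξ : H} (hξ : ξ ∈ M) (hcyc : ∀ x, (∀ a, ⟪π a ξ, x⟫_ℂ = 0) → x = 0) : Ω ∈ M := by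
  have : CompleteSpace M := hM.completeSpace_coe
  have hV : ∀ i j x y, ⟪π (word (J i)) x, π (word (J j)) y⟫_ℂ = if i = j then ⟪x, y⟫_ℂ else 0 := by
    intro i j x y
    rw [inner_map_left, ← mul_apply_eq_comp, ← map_mul, horth]
    split_ifs <;> simp
  have hsumΩ : HasSum (fun j => z j • π (word (J j)) Ω) Ω := by
    refine hasSum_smul_of_hasSum_inner hV hz ?_
    simpa [hΩ, hΩz, Complex.mul_conj'] using Complex.hasSum_ofReal.2 hz
  have hperp : ∀ i, ∀ x ∈ Mᗮ, π (CuntzAlgebra.gen i) x ∈ Mᗮ := by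
    intro i x hx
    rw [Submodule.mem_orthogonal] at hx ⊢
    intro y hy
    rw [inner_map_right]
    exact hx _ (hinv i y hy)
  set v := M.starProjection Ω with hv
  have hvM : v ∈ M := M.starProjection_apply_mem Ω
  have huM : Ω - v ∈ Mᗮ := M.sub_starProjection_mem_orthogonal Ω
  -- Pairing `hsumΩ` with `v` gives `∑ z_j ⟨v, t_j Ω⟩ = ⟨v, Ω⟩ = ‖v‖²`. Here `Ω` may be replaced by
  -- `v` inside `t_j`, since `t_j (Ω - v) ∈ Mᗮ`.
  have hsumv : HasSum (fun j => z j • π (word (J j)) v) v := by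
    refine hasSum_smul_of_hasSum_inner hV hz ?_
    have h := hsumΩ.mapL (innerSL ℂ v)
    simp only [innerSL_apply_apply, inner_smul_right] at h
    have h1 : ∀ x, Ω - x ∈ Mᗮ → ⟪v, Ω⟫_ℂ = ⟪v, x⟫_ℂ := fun x hx => by
      rw [← sub_eq_zero, ← inner_sub_right]
      exact hx v hvM
    have h2 : ∀ j, ⟪v, π (word (J j)) Ω⟫_ℂ = ⟪v, π (word (J j)) v⟫_ℂ := fun j => by
      rw [← sub_eq_zero, ← inner_sub_right, ← map_sub]
      exact word_apply_mem π hperp (J j) huM v hvM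
    rw [h1 v huM, inner_self_eq_norm_sq_to_K] at h
    simp only [h2] at h
    exact h
  have hsumu : HasSum (fun j => z j • π (word (J j)) (Ω - v)) (Ω - v) := by
    simpa only [map_sub, smul_sub] using hsumΩ.sub hsumv
  -- The word span of `Ω - v` lies in `Mᗮ` and is stable under the whole algebra, so `π (star a) (Ω
  -- - v)` is orthogonal to `ξ`.
  have hu : Ω - v = 0 := by
    refine hcyc _ fun a => ?_
    rw [inner_map_left]
    have hmem : Ω - v ∈ wordSpan π (Ω - v) := by
      simpa [word] using word_apply_mem_wordSpan π (Ω - v) []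
    exact wordSpan_le π M.isClosed_orthogonal (fun L => word_apply_mem π hperp L huM)
      (map_mem_wordSpan π hJ hsumu (star a) hmem) ξ hξ
  rw [sub_eq_zero.1 hu]
  exact hvM

end Representation

/-! ### GNS vectors and the space `𝒦(ω)` -/

section GNSVectors

variable {A : Type*} [CStarAlgebra A] [PartialOrder A] [StarOrderedRing A] (ω : CStarState A)

theorem gnsStarAlgHom_apply_cyclicVector (a : A) :
    ω.1.gnsStarAlgHom a ω.cyclicVector = ((ω.1.toPreGNS a : ω.1.PreGNS) : ω.1.GNS) := by
  change ω.1.gnsNonUnitalStarAlgHom a _ = _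
  rw [cyclicVector, PositiveLinearMap.gnsNonUnitalStarAlgHom_apply_coe,
    PositiveLinearMap.leftMulMapPreGNS_apply]
  simp

theorem inner_cyclicVector_apply (a : A) :
    ⟪ω.cyclicVector, ω.1.gnsStarAlgHom a ω.cyclicVector⟫_ℂ = ω a := by
  rw [gnsStarAlgHom_apply_cyclicVector, cyclicVector, UniformSpace.Completion.inner_coe,
    PositiveLinearMap.preGNS_inner_def]
  simp

theorem norm_cyclicVector : ‖ω.cyclicVector‖ = 1 := by
  have h := (ω.inner_cyclicVector_apply 1).trans ω.2
  rw [map_one, one_apply_eq_self, inner_self_eq_norm_sq_to_K] at h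
  have h' : ‖ω.cyclicVector‖ ^ 2 = 1 := Complex.ofReal_injective (by simpa using h)
  exact (pow_eq_one_iff_of_nonneg (norm_nonneg _) two_ne_zero).1 h'

/-- The vectors `π(a) Ω` are the classes of the elements of `A`, which are dense in the completion.
-/
theorem eq_zero_of_inner_apply_cyclicVector {x : ω.1.GNS}
    (hx : ∀ a, ⟪ω.1.gnsStarAlgHom a ω.cyclicVector, x⟫_ℂ = 0) : x = 0 := by
  have h : ∀ y : ω.1.GNS, ⟪y, x⟫_ℂ = 0 := fun y => by
    induction y using UniformSpace.Completion.induction_on with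
    | hp => exact isClosed_eq (by fun_prop) continuous_const
    | ih y =>
      rw [← hx (ω.1.ofPreGNS y), gnsStarAlgHom_apply_cyclicVector]
      rfl
  exact inner_self_eq_zero.1 (h x)

end GNSVectors

theorem adjoint_word_mem_corrSpace (ω : CStarState (CuntzAlgebra n)) (J : List (Fin n)) :
    ω.1.gnsStarAlgHom (star (word J)) ω.cyclicVector ∈ ω.corrSpace := by
  rw [map_star, ContinuousLinearMap.star_eq_adjoint]
  exact Submodule.le_topologicalClosure _ (Submodule.subset_span ⟨J, rfl⟩)

theorem isClosed_corrSpace (ω : CStarState (CuntzAlgebra n)) :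
    IsClosed (ω.corrSpace : Set ω.1.GNS) :=
  Submodule.isClosed_topologicalClosure _

theorem corrSpace_le (ω : CStarState (CuntzAlgebra n)) {N : Submodule ℂ ω.1.GNS}
    (hN : IsClosed (N : Set ω.1.GNS))
    (h : ∀ J, ω.1.gnsStarAlgHom (star (word J)) ω.cyclicVector ∈ N) : ω.corrSpace ≤ N := by
  refine Submodule.topologicalClosure_minimal _
    (Submodule.span_le.2 (Set.range_subset_iff.2 fun J => ?_)) hN
  rw [← ContinuousLinearMap.star_eq_adjoint, ← map_star]
  exact h J

theorem cyclicVector_mem_corrSpace (ω : CStarState (CuntzAlgebra n)) :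
    ω.cyclicVector ∈ ω.corrSpace := by
  simpa [word] using ω.adjoint_word_mem_corrSpace []

/-- `sᵢ* s_J* = (s_J sᵢ)*`: the new letter is appended at the end of `J`. -/
theorem star_gen_apply_mem_corrSpace (ω : CStarState (CuntzAlgebra n)) (i : Fin n) {x : ω.1.GNS}
    (hx : x ∈ ω.corrSpace) : ω.1.gnsStarAlgHom (star (CuntzAlgebra.gen i)) x ∈ ω.corrSpace := by
  refine ω.corrSpace_le (N := ω.corrSpace.comap
    (ω.1.gnsStarAlgHom (star (CuntzAlgebra.gen i)) : ω.1.GNS →ₗ[ℂ] ω.1.GNS))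
    (ω.isClosed_corrSpace.preimage (ContinuousLinearMap.continuous _)) (fun J => ?_) hx
  have h := ω.adjoint_word_mem_corrSpace (J ++ [i])
  rw [word_append, star_mul, map_mul] at h
  simpa [word] using h

/-- If `ω` takes the values `conj z_j`, for a unit vector `z`, on nonempty words with pairwise
orthogonal ranges, then `ω` is minimal. -/
theorem isMinimal_of_words {ι : Type*} [DecidableEq ι] {J : ι → List (Fin n)}
    (hJ : ∀ j, J j ≠ [])
    (horth : ∀ i j, star (word (J i)) * word (J j) = if i = j then 1 else 0)
    {z : ι → ℂ} (hz : HasSum (fun j => ‖z j‖ ^ 2) 1) {ω : CStarState (CuntzAlgebra n)}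
    (hωz : ∀ j, ω (word (J j)) = star (z j)) : ω.IsMinimal := by
  -- `κ(ω) ≤ cdim ω` because `ω` is equivalent to itself; the content is the other inequality.
  refine le_antisymm (le_sInf ?_) (sInf_le ⟨ω, ⟨.refl ℂ _, fun _ _ => rfl⟩, rfl⟩)
  rintro _ ⟨ω', ⟨U, hU⟩, rfl⟩
  have hUs : ∀ a x, U.symm (ω.1.gnsStarAlgHom a x) = ω'.1.gnsStarAlgHom a (U.symm x) :=
    fun a x => by rw [LinearIsometryEquiv.symm_apply_eq, hU, U.apply_symm_apply]
  have hmem : U.symm ω.cyclicVector ∈ ω'.corrSpace := by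
    refine mem_of_cyclic ω'.1.gnsStarAlgHom hJ horth hz ?_ (fun j => ?_) ω'.isClosed_corrSpace
      (fun i x hx => ω'.star_gen_apply_mem_corrSpace i hx) ω'.cyclicVector_mem_corrSpace
      (fun x hx => ω'.eq_zero_of_inner_apply_cyclicVector hx)
    · rw [LinearIsometryEquiv.norm_map, norm_cyclicVector]
    · rw [← hUs, LinearIsometryEquiv.inner_map_map, inner_cyclicVector_apply, hωz]
  -- Since `U.symm Ω` is in `𝒦(ω')`, so are all its images under `s_J*`, which span the image of
  -- `𝒦(ω)` densely.
  have hle : ω.corrSpace ≤ ω'.corrSpace.comap (U.symm.toLinearEquiv : ω.1.GNS →ₗ[ℂ] ω'.1.GNS) := by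
    refine ω.corrSpace_le (ω'.isClosed_corrSpace.preimage U.symm.continuous) fun L => ?_
    change U.symm (ω.1.gnsStarAlgHom (star (word L)) ω.cyclicVector) ∈ ω'.corrSpace
    rw [hUs]
    exact star_word_apply_mem _ (fun i x hx => ω'.star_gen_apply_mem_corrSpace i hx) L hmem
  refine Cardinal.toENat.monotone' (LinearMap.rank_le_of_injective
    ((U.symm.toLinearEquiv : ω.1.GNS →ₗ[ℂ] ω'.1.GNS).restrict hle) ?_)
  intro x y hxy
  exact Subtype.ext (U.symm.injective (congrArg Subtype.val hxy))

/-! ### The words of a geometric progression -/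

/-- The word `sₙʳ s_{i+1}` as a list of indices. -/
def progressionWord (hn : 2 ≤ n) (p : ℕ × Fin (n - 1)) : List (Fin n) :=
  List.replicate p.1 ⟨n - 1, by omega⟩ ++ [⟨p.2, by omega⟩]

theorem word_replicate_last (hn : 2 ≤ n) (r : ℕ) :
    word (List.replicate r (⟨n - 1, by omega⟩ : Fin n)) = lastGen hn ^ r := by
  simp [word, lastGen]

theorem word_progressionWord (hn : 2 ≤ n) (p : ℕ × Fin (n - 1)) :
    word (progressionWord hn p) = lastGen hn ^ p.1 * initGen p.2 := by
  rw [progressionWord, word_append, word_replicate_last hn]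
  simp [word, initGen]

theorem star_lastGen_pow_mul_lastGen_pow (hn : 2 ≤ n) (r : ℕ) :
    star (lastGen hn ^ r) * lastGen hn ^ r = 1 := by
  induction r with
  | zero => simp
  | succ r ih =>
    rw [pow_succ, star_mul, mul_assoc, ← mul_assoc (star _) (_ ^ r), ih, one_mul, lastGen,
      CuntzAlgebra.star_gen_mul_gen, if_pos rfl]

theorem star_initGen_mul_lastGen (hn : 2 ≤ n) (i : Fin (n - 1)) :
    star (initGen i) * lastGen hn = 0 := by
  rw [initGen, lastGen, CuntzAlgebra.star_gen_mul_gen, if_neg]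
  have := i.2
  simp only [Fin.mk.injEq]
  omega

/-- The common power of `sₙ` cancels; as `p.1 < k`, at least one factor `sₙ` remains, and `sᵢ*`
kills it. -/
theorem star_progression_mul_lastGen_pow (hn : 2 ≤ n) (p : ℕ × Fin (n - 1)) {k : ℕ}
    (hk : p.1 < k) : star (lastGen hn ^ p.1 * initGen p.2) * lastGen hn ^ k = 0 := by
  obtain ⟨d, rfl⟩ := Nat.exists_eq_add_of_lt hk
  rw [star_mul, add_assoc, pow_add, mul_assoc, ← mul_assoc (star (_ ^ _)),
    star_lastGen_pow_mul_lastGen_pow, one_mul, pow_succ', ← mul_assoc, star_initGen_mul_lastGen,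
    zero_mul]

theorem star_progression_mul_progression (hn : 2 ≤ n) (p q : ℕ × Fin (n - 1)) :
    star (lastGen hn ^ p.1 * initGen p.2) * (lastGen hn ^ q.1 * initGen q.2) =
      if p = q then 1 else 0 := by
  rcases lt_trichotomy p.1 q.1 with h | h | h
  · rw [← mul_assoc, star_progression_mul_lastGen_pow hn p h, zero_mul,
      if_neg (fun e => h.ne (congrArg _ e))]
  · rw [h, star_mul, mul_assoc, ← mul_assoc (star (_ ^ _)), star_lastGen_pow_mul_lastGen_pow,
      one_mul, initGen, initGen, CuntzAlgebra.star_gen_mul_gen]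
    simp [Prod.ext_iff, h, Fin.ext_iff]
  · rw [← star_star (_ * _), star_mul, star_star, ← mul_assoc,
      star_progression_mul_lastGen_pow hn q h, zero_mul, star_zero,
      if_neg (fun e => h.ne' (congrArg _ e))]

theorem IsGeometricL2.isMinimal {hn : 2 ≤ n} {z : lp (fun _ : ℕ => ℂ) 2} (hz : ‖z‖ = 1)
    {ω : CStarState (CuntzAlgebra n)} (h : ω.IsGeometricL2 hn z) : ω.IsMinimal := by
  have : NeZero (n - 1) := ⟨by omega⟩
  refine isMinimal_of_words (J := progressionWord hn)
    (z := fun p : ℕ × Fin (n - 1) => z ((n - 1) * p.1 + p.2)) (fun p => by simp [progressionWord])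
    (fun p q => ?_) ?_ fun p => ?_
  · simp only [word_progressionWord, star_progression_mul_progression]
  · have h2 := lp.hasSum_norm (p := 2) (by norm_num) z
    rw [hz] at h2
    -- Division with remainder by `n - 1` matches the coordinates of `z` with the pairs `(r, i)`.
    rw [← (Nat.divModEquiv (n - 1)).hasSum_iff]
    simpa [Function.comp_def, Nat.div_add_mod] using h2
  · rw [word_progressionWord]
    exact h p.1 p.2

theorem IsGeometricOfOrder.isMinimal {hn : 2 ≤ n} {k : ℕ}
    (hk : k ≠ 0) {z : EuclideanSpace ℂ (Fin ((n - 1) * k + 1))} (hz : ‖z‖ = 1)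
    {ω : CStarState (CuntzAlgebra n)} (h : ω.IsGeometricOfOrder hn k z) : ω.IsMinimal := by
  -- `none` indexes the extra word `sₙᵏ`, nonempty since `k ≠ 0`.
  refine isMinimal_of_words
    (J := fun o : Option (Fin k × Fin (n - 1)) =>
      o.elim (List.replicate k ⟨n - 1, by omega⟩) fun p => progressionWord hn (p.1, p.2))
    (z := fun o => o.elim (z (Fin.last _)) fun p => z ⟨(n - 1) * p.1 + p.2, index_lt p.1 p.2⟩)
    ?_ ?_ ?_ ?_
  · rintro (_ | p) <;> simp [progressionWord, hk]
  · rintro (_ | p) (_ | q)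
    · simp only [Option.elim, word_replicate_last hn, star_lastGen_pow_mul_lastGen_pow, if_true]
    · simp only [Option.elim, word_replicate_last hn, word_progressionWord]
      have h0 := congrArg star (star_progression_mul_lastGen_pow hn (q.1, q.2) q.1.2)
      rw [star_mul, star_star, star_zero] at h0
      simpa only [reduceCtorEq, if_false] using h0
    · simp only [Option.elim, word_replicate_last hn, word_progressionWord]
      simpa only [reduceCtorEq, if_false] using
        star_progression_mul_lastGen_pow hn (p.1, p.2) p.1.2
    · simp only [Option.elim, word_progressionWord]
      rw [star_progression_mul_progression hn (p.1, p.2) (q.1, q.2)]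
      simp [Prod.ext_iff, Fin.ext_iff]
  · have h2 : ∑ j, ‖z j‖ ^ 2 = 1 := by rw [← EuclideanSpace.norm_sq_eq, hz, one_pow]
    -- The last coordinate splits off for `none`. The others are indexed by `(r, i) ↦ (n - 1) * r +
    -- i`, where `finCongr` only swaps the factors of `k * (n - 1)`.
    rw [Fin.sum_univ_castSucc, ← (finProdFinEquiv.trans (finCongr (mul_comm k (n - 1)))).sum_comp,
      add_comm] at h2
    rw [← h2]
    convert! hasSum_fintype _
    rw [Fintype.sum_option]
    congr 1
    refine Finset.sum_congr rfl fun p _ => ?_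
    have hp : (finProdFinEquiv.trans (finCongr (mul_comm k (n - 1))) p).castSucc =
        ⟨(n - 1) * p.1 + p.2, index_lt p.1 p.2⟩ := by
      simp [Fin.ext_iff, add_comm]
    rw [hp]
    rfl
  · rintro (_ | p)
    · simpa only [Option.elim, word_replicate_last hn] using h.2
    · simpa only [Option.elim, word_progressionWord] using h.1 p.1 p.2

end CStarState

theorem proposition3p7 (n : ℕ) (hn : 2 ≤ n) (ω : CStarState (CuntzAlgebra n))
    (hω : ω.IsGeometricProgressionState hn) : ω.IsMinimal := by
  rcases hω with ⟨k, hk, z, hz, h⟩ | ⟨z, hz, h⟩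
  · exact h.isMinimal (by omega) hz
  · exact h.isMinimal hz
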